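/- Consider deterministic Turing machines with finitely many states, an accepting and a rejecting halting state, one head, and one tape that is infinite to the right only and whose cells are either blank ($0$) or marked ($1$); the head stays in place if it is told to move left from the first cell. Such a machine is write-once if it never writes a blank to a marked cell (marking a marked cell again is allowed). Let $\Sigma$ be a finite alphabet. Fix an injective encoding of its letters by blocks of cells of one common length, such that each block used contains at least one marked and at least one blank cell. A machine is given a word $w\in\Sigma^*$ by writing the blocks of its letters one after another from the first cell on, all other cells being blank, with the head on the first cell. It decides a language $L\subseteq\Sigma^*$ in time $T$ if on every $w\in\Sigma^*$ it halts after at most $T(|w|)$ steps, in the accepting state if $w\in L$ and in the rejecting state if $w\notin L$. Put $\exp_0(m)=m$ and $\exp_{k+1}(m)=2^{\exp_k(m)}$. Let $k$-ExpTime be the class of languages over $\Sigma$ that are decided by such a machine in time $a\exp_k(n^t)+a$ for some $t,a\in\mathbb N$, and let $k$-DExpWOTime be the class of those that are decided within such a time bound by a write-once machine. Theorem. For every finite alphabet $\Sigma$, every such encoding and every $k\ge 0$, $$k\text{-DExpWOTime} = k\text{-ExpTime}.$$ -/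

import Mathlib

namespace WOTM

/-- Head movements. -/
inductive Move : Type
  | left
  | stay
  | right

/-- The cell reached from cell `i`; the tape has no cell to the left of cell `0`,
and the head stays there when it is told to move left. -/
def Move.apply : Move → ℕ → ℕ
  | .left, i => i - 1
  | .stay, i => i
  | .right, i => i + 1

/-- A deterministic Turing machine with a finite set of states, one head and one tape, whose cells
are blank (`false`) or marked (`true`). In state `q`, reading `b`, the machine does
`trans q b = (new state, symbol written, movement)`. -/
structure Machine where
  State : Type
  [fintypeState : Fintype State]
  [decEqState : DecidableEq State]
  trans : State → Bool → State × Bool × Move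
  start : State
  accept : State
  reject : State
  accept_ne_reject : accept ≠ reject

attribute [instance] Machine.fintypeState Machine.decEqState

/-- A write-once machine never writes a blank to a marked cell
(marking a marked cell again is allowed). -/
def Machine.IsWriteOnce (M : Machine) : Prop :=
  ∀ q : M.State, (M.trans q true).2.1 = true

/-- Configurations. The tape is infinite to the right only. -/
structure Machine.Cfg (M : Machine) where
  state : M.State
  head : ℕ
  tape : ℕ → Bool

/-- One step of computation; a configuration in the accepting or rejecting state is final. -/
def Machine.step (M : Machine) (c : M.Cfg) : M.Cfg :=
  if c.state = M.accept ∨ c.state = M.reject then c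
  else
    let r := M.trans c.state (c.tape c.head)
    { state := r.1
      head := r.2.2.apply c.head
      tape := Function.update c.tape c.head r.2.1 }

/-- A presentation of an input alphabet `α` on a two-symbol tape: each letter is written in a block
of `width` cells, different letters as different blocks. No letter is a fully blank block (so that
the end of the input is visible) and none is a fully marked block. -/
structure BlockCode (α : Type*) where
  width : ℕ
  code : α → List Bool
  length_code : ∀ a, (code a).length = width
  injective : Function.Injective code
  exists_marked : ∀ a, true ∈ code a
  exists_blank : ∀ a, false ∈ code a

/-- The tape holding the word `w` from cell `0` on, followed by blanks only. -/
def BlockCode.inputTape {α : Type*} (c : BlockCode α) (w : List α) : ℕ → Bool :=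
  fun i => (w.flatMap c.code).getD i false

/-- The initial configuration on the input `w`. -/
def Machine.init {α : Type*} (M : Machine) (c : BlockCode α) (w : List α) : M.Cfg where
  state := M.start
  head := 0
  tape := c.inputTape w

/-- `M` decides `L`, halting on each word of length `n` after at most `T n` steps. -/
def Machine.DecidesInTime {α : Type*} (M : Machine) (c : BlockCode α) (L : Language α)
    (T : ℕ → ℕ) : Prop :=
  ∀ w : List α, ∃ s ≤ T w.length,
    (w ∈ L → (M.step^[s] (M.init c w)).state = M.accept) ∧
    (w ∉ L → (M.step^[s] (M.init c w)).state = M.reject)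

/-- The `k`-fold exponential: `kexp 0 m = m` and `kexp (k + 1) m = 2 ^ kexp k m`. -/
def kexp : ℕ → ℕ → ℕ
  | 0, m => m
  | k + 1, m => 2 ^ kexp k m

/-- `k`-ExpTime: the languages decided by a deterministic machine in time `O(kexp k (n ^ t))`
for some `t`. -/
def ExpTime {α : Type*} (c : BlockCode α) (k : ℕ) : Set (Language α) :=
  {L | ∃ (M : Machine) (t a : ℕ),
    M.DecidesInTime c L (fun n => a * kexp k (n ^ t) + a)}

/-- `k`-DExpWOTime: the languages decided by a deterministic write-once machine in time
`O(kexp k (n ^ t))` for some `t`. -/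
def DExpWOTime {α : Type*} (c : BlockCode α) (k : ℕ) : Set (Language α) :=
  {L | ∃ (M : Machine) (t a : ℕ), M.IsWriteOnce ∧
    M.DecidesInTime c L (fun n => a * kexp k (n ^ t) + a)}

end WOTM

namespace WOTM

/-! Only the inclusion of `ExpTime` in `DExpWOTime` needs work. A write-once machine cannot update a
configuration in place, but it can copy it to fresh tape while updating it, and use up the old copy.

Take blocks of `m + 2` cells as symbols, `m + 2` being the length of the letter codes. With the
pointwise order on blocks, writing once means that symbols only grow. The blank block `⊥` and the
full block `⊤` never encode data. The tape has the form `⊤ … ⊤ u ⊥ v`: used blocks, unread input,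
separator, output so far. To read a symbol, the machine turns it into `⊤`, walks to the end of `v`,
appends the output and returns to the last `⊤`. Once `u` is exhausted, the separator also becomes
`⊤`, `v` becomes the input, and the blank after it serves as the next separator. Thus a finite
transducer can be run on its own output again and again (`Transducer.reaches_run`).

One pass of a transducer carries out one step of `M` on a list of cells with head marks
(`exists_pass_eq_step`); a preliminary pass turns the input word into such a list. Used blocks are
never crossed again, so a pass costs quadratic time in the length of the current configuration,
which grows by at most one cell per step. The overhead is therefore cubic, and it is absorbed by the
exponent `t` (`exists_kexp_bound`). -/

/-- A deterministic machine with one one-sided tape over an arbitrary alphabet. -/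
structure TapeMachine (Γ : Type) where
  State : Type
  [finite : Finite State]
  trans : State → Γ → State × Γ × Move
  start : State
  accept : State
  reject : State
  accept_ne_reject : accept ≠ reject

namespace TapeMachine

variable {Γ : Type}

/-- Configurations of a tape machine. -/
@[ext] structure Cfg (M : TapeMachine Γ) where
  state : M.State
  head : ℕ
  tape : ℕ → Γ

open Classical in
/-- One step of a tape machine. -/
noncomputable def step (M : TapeMachine Γ) (c : M.Cfg) : M.Cfg :=
  if c.state = M.accept ∨ c.state = M.reject then c
  else
    let r := M.trans c.state (c.tape c.head)
    { state := r.1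
      head := r.2.2.apply c.head
      tape := Function.update c.tape c.head r.2.1 }

/-- `c'` is reached from `c` in at most `s` steps. -/
def Reaches (M : TapeMachine Γ) (s : ℕ) (c c' : M.Cfg) : Prop :=
  ∃ k ≤ s, M.step^[k] c = c'

theorem Reaches.refl {M : TapeMachine Γ} (c : M.Cfg) : M.Reaches 0 c c := ⟨0, le_rfl, rfl⟩

theorem Reaches.trans {M : TapeMachine Γ} {s s' : ℕ} {c c' c'' : M.Cfg}
    (h : M.Reaches s c c') (h' : M.Reaches s' c' c'') : M.Reaches (s + s') c c'' := by
  obtain ⟨k, hk, rfl⟩ := h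
  obtain ⟨k', hk', rfl⟩ := h'
  exact ⟨k' + k, by omega, Function.iterate_add_apply ..⟩

theorem Reaches.mono {M : TapeMachine Γ} {s s' : ℕ} {c c' : M.Cfg}
    (h : M.Reaches s c c') (hs : s ≤ s') : M.Reaches s' c c' := by
  obtain ⟨k, hk, e⟩ := h
  exact ⟨k, hk.trans hs, e⟩

theorem Reaches.single {M : TapeMachine Γ} {c c' : M.Cfg} (h : M.step c = c') :
    M.Reaches 1 c c' := ⟨1, le_rfl, h⟩

end TapeMachine

/-! ### Machines over blocks, simulated on a two-symbol tape -/

/-- States of the two-symbol machine that treats `n + 1` consecutive cells as one cell: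
it reads the block from left to right, rewrites it from right to left, and moves the head. -/
inductive BlockState (Q : Type) (n : ℕ) : Type
  | scan (q : Q) (j : Fin (n + 1)) (g : Fin (n + 1) → Bool)
  | write (q : Q) (j : Fin (n + 1)) (g : Fin (n + 1) → Bool) (m : Move)
  | shift (q : Q) (j : Fin (n + 1)) (m : Move)

instance : Finite Move :=
  Finite.of_injective (fun m : Move => match m with
    | .left => (0 : Fin 3) | .stay => 1 | .right => 2) (by
    intro a b; cases a <;> cases b <;> simp)

instance {Q : Type} [Finite Q] {n : ℕ} : Finite (BlockState Q n) :=
  Finite.of_injective (β := (Q × Fin (n + 1) × (Fin (n + 1) → Bool)) ⊕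
      (Q × Fin (n + 1) × (Fin (n + 1) → Bool) × Move) ⊕ (Q × Fin (n + 1) × Move))
    (fun s => match s with
      | .scan q j g => .inl (q, j, g)
      | .write q j g m => .inr (.inl (q, j, g, m))
      | .shift q j m => .inr (.inr (q, j, m))) (by
    intro a b
    cases a <;> cases b <;> simp)

variable {n : ℕ}

/-- Transition function of the two-symbol machine simulating a machine over blocks. -/
def blockTrans (M : TapeMachine (Fin (n + 1) → Bool)) :
    BlockState M.State n → Bool → BlockState M.State n × Bool × Move
  | .scan q j g, b =>
    if j.val = n then
      (.write (M.trans q (Function.update g j b)).1 j (M.trans q (Function.update g j b)).2.1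
        (M.trans q (Function.update g j b)).2.2, b, .stay)
    else (.scan q (Fin.ofNat (n + 1) (j.val + 1)) (Function.update g j b), b, .right)
  | .write q j g m, b =>
    if j.val = 0 then (.shift q (Fin.last n) m, b || g j, .stay)
    else (.write q (Fin.ofNat (n + 1) (j.val - 1)) g m, b || g j, .left)
  | .shift q j m, b =>
    -- The memory is reset to `⊥`, so that each simulated state, in particular each halting one, has
    -- a single representative between rounds.
    (if j.val = 0 then .scan q 0 ⊥ else .shift q (Fin.ofNat (n + 1) (j.val - 1)) m, b, m)

/-- The two-symbol machine simulating a machine over blocks of `n + 1` cells. -/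
noncomputable def TapeMachine.toMachine (M : TapeMachine (Fin (n + 1) → Bool)) : Machine :=
  haveI := M.finite
  { State := BlockState M.State n
    fintypeState := Fintype.ofFinite _
    decEqState := Classical.decEq _
    trans := blockTrans M
    start := .scan M.start 0 ⊥
    accept := .scan M.accept 0 ⊥
    reject := .scan M.reject 0 ⊥
    accept_ne_reject := by simpa using M.accept_ne_reject }

/-- New blocks are or-ed onto the old ones, so this needs no monotonicity of `M`; monotonicity only
makes the simulation faithful. -/
theorem TapeMachine.toMachine_isWriteOnce (M : TapeMachine (Fin (n + 1) → Bool)) :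
    M.toMachine.IsWriteOnce := by
  intro q
  change (blockTrans M q true).2.1 = true
  cases q <;> simp only [blockTrans] <;> split_ifs <;> simp

/-- The two-symbol tape obtained by writing out the blocks of a tape over blocks. -/
def unblock (t : ℕ → Fin (n + 1) → Bool) : ℕ → Bool :=
  fun i => t (i / (n + 1)) (Fin.ofNat (n + 1) i)

/-- The two-symbol configuration representing a configuration over blocks. -/
noncomputable def TapeMachine.Cfg.unblock {M : TapeMachine (Fin (n + 1) → Bool)} (c : M.Cfg) :
    M.toMachine.Cfg where
  state := BlockState.scan c.state 0 ⊥
  head := c.head * (n + 1)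
  tape := WOTM.unblock c.tape

section Simulation

variable (M : TapeMachine (Fin (n + 1) → Bool))

theorem toMachine_step (s : BlockState M.State n) (h : ℕ) (t : ℕ → Bool)
    (hs : s ≠ .scan M.accept 0 ⊥ ∧ s ≠ .scan M.reject 0 ⊥) :
    M.toMachine.step ⟨s, h, t⟩ = ⟨(blockTrans M s (t h)).1,
      (blockTrans M s (t h)).2.2.apply h, Function.update t h (blockTrans M s (t h)).2.1⟩ :=
  if_neg (by rintro (e | e); exacts [hs.1 e, hs.2 e])

theorem iterate_scan (q : M.State) (hq : q ≠ M.accept ∧ q ≠ M.reject) (h : ℕ) (t : ℕ → Bool)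
    (j : ℕ) (hj : j ≤ n) :
    M.toMachine.step^[j] ⟨BlockState.scan q 0 ⊥, h, t⟩ =
      ⟨BlockState.scan q (Fin.ofNat (n + 1) j) (fun i => if i.val < j then t (h + i) else false),
        h + j, t⟩ := by
  induction j with
  | zero => simp; rfl
  | succ j ih =>
    rw [Function.iterate_succ_apply', ih (by omega),
      toMachine_step M _ _ _ (by simp [hq.1, hq.2])]
    have hm : j % (n + 1) = j := Nat.mod_eq_of_lt (by omega)
    have hne : ¬ (j = n) := by omega
    simp only [blockTrans, Fin.val_ofNat, hm, if_neg hne, Function.update_eq_self, Move.apply,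
      Nat.add_assoc]
    congr 2
    funext i
    by_cases hi : i.val = j
    · have : i = Fin.ofNat (n + 1) j := Fin.ext (by simp [hm, hi])
      subst this
      simp [hm]
    · rw [Function.update_of_ne (by intro e; apply hi; rw [e]; simp [hm])]
      have : (i.val < j) = (i.val < j + 1) := by apply propext; omega
      simp only [this]

theorem iterate_write (q : M.State) (g : Fin (n + 1) → Bool) (m : Move) (h : ℕ) (j : ℕ)
    (hj : j ≤ n) (t : ℕ → Bool) :
    M.toMachine.step^[j + 1] ⟨BlockState.write q (Fin.ofNat (n + 1) j) g m, h + j, t⟩ =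
      ⟨BlockState.shift q (Fin.last n) m, h,
        fun x => if h ≤ x ∧ x ≤ h + j then t x || g (Fin.ofNat (n + 1) (x - h)) else t x⟩ := by
  induction j generalizing t with
  | zero =>
    rw [Function.iterate_one, toMachine_step M _ _ _ (by simp)]
    simp only [blockTrans, Fin.val_ofNat, Nat.zero_mod, if_true, Move.apply]
    congr 1
    funext x
    by_cases hx : x = h
    · subst hx; simp
    · rw [Function.update_of_ne (by simpa using hx), if_neg (by omega)]
  | succ j ih =>
    rw [Function.iterate_succ_apply, toMachine_step M _ _ _ (by simp)]
    have hm : (j + 1) % (n + 1) = j + 1 := Nat.mod_eq_of_lt (by omega)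
    simp only [blockTrans, Fin.val_ofNat, hm, Nat.succ_ne_zero, if_false, Move.apply,
      Nat.add_sub_cancel]
    rw [show h + (j + 1) - 1 = h + j by omega, ih (by omega)]
    congr 1
    funext x
    by_cases hx : x = h + (j + 1)
    · subst hx; simp
    · rw [Function.update_of_ne hx]
      have : (h ≤ x ∧ x ≤ h + j) = (h ≤ x ∧ x ≤ h + (j + 1)) := by apply propext; omega
      simp only [this]

theorem iterate_shift (q : M.State) (m : Move) (h : ℕ) (j : ℕ) (hj : j ≤ n) (t : ℕ → Bool) :
    M.toMachine.step^[j + 1] ⟨BlockState.shift q (Fin.ofNat (n + 1) j) m, h, t⟩ =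
      ⟨BlockState.scan q 0 ⊥, m.apply^[j + 1] h, t⟩ := by
  induction j generalizing h with
  | zero =>
    rw [Function.iterate_one, toMachine_step M _ _ _ (by simp)]
    simp [blockTrans]
  | succ j ih =>
    rw [Function.iterate_succ_apply, toMachine_step M _ _ _ (by simp)]
    have hm : (j + 1) % (n + 1) = j + 1 := Nat.mod_eq_of_lt (by omega)
    simp only [blockTrans, Fin.val_ofNat, hm, Nat.succ_ne_zero, if_false,
      Nat.add_sub_cancel, Function.update_eq_self]
    exact ih _ (by omega)

/-- The left edge causes no trouble: truncated subtraction gives `k * w - w = (k - 1) * w` for `k =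
0` too. -/
theorem Move.iterate_apply_mul (m : Move) (k w : ℕ) : m.apply^[w] (k * w) = m.apply k * w := by
  have left (i h : ℕ) : Move.left.apply^[i] h = h - i := by
    induction i generalizing h with
    | zero => rfl
    | succ i ih => rw [Function.iterate_succ_apply, ih]; simp only [Move.apply]; omega
  have right (i h : ℕ) : Move.right.apply^[i] h = h + i := by
    induction i generalizing h with
    | zero => rfl
    | succ i ih => rw [Function.iterate_succ_apply, ih]; simp only [Move.apply]; omega
  have stay (i h : ℕ) : Move.stay.apply^[i] h = h := by
    induction i generalizing h with
    | zero => rfl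
    | succ i ih => rw [Function.iterate_succ_apply, ih]; rfl
  cases m
  · rw [left]; simp only [Move.apply]; rw [Nat.sub_mul, Nat.one_mul]
  · rw [stay]; rfl
  · rw [right]; simp only [Move.apply]; ring

theorem unblock_block (t : ℕ → Fin (n + 1) → Bool) (k : ℕ) (i : Fin (n + 1)) :
    unblock t (k * (n + 1) + i) = t k i := by
  have h1 : (k * (n + 1) + i) / (n + 1) = k := by
    rw [Nat.add_comm, Nat.add_mul_div_right _ _ (Nat.succ_pos n), Nat.div_eq_of_lt i.2, zero_add]
  have h2 : Fin.ofNat (n + 1) (k * (n + 1) + i) = i := by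
    apply Fin.ext
    simp [Nat.mod_eq_of_lt i.2]
  rw [unblock, h1, h2]

/-- Scanning, writing and shifting take `n + 1` steps each. -/
theorem toMachine_iterate_step (hM : ∀ q g, g ≤ (M.trans q g).2.1) (c : M.Cfg)
    (hc : c.state ≠ M.accept ∧ c.state ≠ M.reject) :
    M.toMachine.step^[3 * (n + 1)] c.unblock = (M.step c).unblock := by
  obtain ⟨q, k, t⟩ := c
  have hscan := iterate_scan M q hc (k * (n + 1)) (unblock t) n le_rfl
  set r := M.trans q (t k) with hr
  have hread : Function.update (fun i : Fin (n + 1) => if i.val < n then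
      unblock t (k * (n + 1) + i) else false) (Fin.ofNat (n + 1) n)
        (unblock t (k * (n + 1) + n)) = t k := by
    funext i
    by_cases hi : i.val < n
    · rw [Function.update_of_ne (by rintro rfl; simp at hi)]
      simp only [hi, if_true, unblock_block]
    · have : i = Fin.ofNat (n + 1) n := Fin.ext (by simp; omega)
      rw [this, Function.update_self]
      have := unblock_block t k (Fin.ofNat (n + 1) n)
      simpa using this
  have hturn : M.toMachine.step^[n + 1] ⟨BlockState.scan q 0 ⊥, k * (n + 1), unblock t⟩ =
      ⟨BlockState.write r.1 (Fin.ofNat (n + 1) n) r.2.1 r.2.2, k * (n + 1) + n, unblock t⟩ := by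
    rw [Function.iterate_succ_apply', hscan, toMachine_step M _ _ _ (by simp [hc.1, hc.2])]
    simp only [blockTrans, Fin.val_ofNat, Nat.mod_eq_of_lt (Nat.lt_succ_self n), if_true, hread,
      ← hr, Function.update_eq_self, Move.apply]
  have hlast : Fin.last n = Fin.ofNat (n + 1) n := Fin.ext (by simp)
  rw [show 3 * (n + 1) = (n + 1) + ((n + 1) + (n + 1)) by ring,
    Function.iterate_add_apply _ (n + 1), Function.iterate_add_apply _ (n + 1) (n + 1)]
  change M.toMachine.step^[n + 1] (M.toMachine.step^[n + 1] (M.toMachine.step^[n + 1]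
    ⟨BlockState.scan q 0 ⊥, k * (n + 1), unblock t⟩)) = _
  rw [hturn, iterate_write M _ _ _ _ _ le_rfl, hlast, iterate_shift M _ _ _ _ le_rfl,
    Move.iterate_apply_mul]
  have hstep : M.step ⟨q, k, t⟩ = ⟨r.1, r.2.2.apply k, Function.update t k r.2.1⟩ :=
    if_neg (by rintro (e | e); exacts [hc.1 e, hc.2 e])
  rw [hstep]
  simp only [TapeMachine.Cfg.unblock]
  congr 1
  funext x
  obtain ⟨i, l, hl, rfl⟩ : ∃ i l, l < n + 1 ∧ x = i * (n + 1) + l :=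
    ⟨x / (n + 1), x % (n + 1), Nat.mod_lt _ (Nat.succ_pos n), (Nat.div_add_mod' x (n + 1)).symm⟩
  rw [show i * (n + 1) + l = i * (n + 1) + (⟨l, hl⟩ : Fin (n + 1)) from rfl, unblock_block,
    unblock_block]
  by_cases hik : i = k
  · subst hik
    rw [if_pos ⟨by simp, by simp; omega⟩, Function.update_self]
    have e : Fin.ofNat (n + 1) (i * (n + 1) + (⟨l, hl⟩ : Fin (n + 1)) - i * (n + 1)) = ⟨l, hl⟩ :=
      Fin.ext (by simp [Nat.mod_eq_of_lt hl])
    rw [e]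
    -- Since the old bit is at most the new one, their disjunction is the new one.
    have := hM q (t i) ⟨l, hl⟩
    rw [← hr] at this
    revert this
    cases t i ⟨l, hl⟩ <;> cases r.2.1 ⟨l, hl⟩ <;> simp
  · rw [Function.update_of_ne hik, if_neg]
    rintro ⟨h1, h2⟩
    apply hik
    simp only at h1 h2
    apply le_antisymm
    · by_contra hlt
      have := Nat.mul_le_mul_right (n + 1) (show k + 1 ≤ i by omega)
      rw [Nat.add_mul] at this
      omega
    · by_contra hlt
      have := Nat.mul_le_mul_right (n + 1) (show i + 1 ≤ k by omega)
      rw [Nat.add_mul] at this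
      omega

theorem Machine.iterate_step_of_halted {M : Machine} {c : M.Cfg}
    (hc : c.state = M.accept ∨ c.state = M.reject) (s : ℕ) : M.step^[s] c = c :=
  Function.iterate_fixed (show M.step c = c from if_pos hc) s

theorem toMachine_iterate (hM : ∀ q g, g ≤ (M.trans q g).2.1) (s : ℕ) (c : M.Cfg) :
    M.toMachine.step^[3 * (n + 1) * s] c.unblock = (M.step^[s] c).unblock := by
  induction s generalizing c with
  | zero => rfl
  | succ s ih =>
    rw [Nat.mul_succ, Function.iterate_add_apply, Function.iterate_succ_apply, ← ih]
    congr 1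
    by_cases hc : c.state = M.accept ∨ c.state = M.reject
    · rw [show M.step c = c from if_pos hc]
      refine Machine.iterate_step_of_halted ?_ _
      rcases hc with h | h
      · exact .inl (by simp only [TapeMachine.Cfg.unblock, h]; rfl)
      · exact .inr (by simp only [TapeMachine.Cfg.unblock, h]; rfl)
    · exact toMachine_iterate_step M hM c (not_or.1 hc)

end Simulation

/-! ### Tapes given by lists -/

/-- The tape holding the list `l` from cell `0` on, all other cells holding `d`. -/
def tapeOf {Γ : Type} (d : Γ) (l : List Γ) : ℕ → Γ := fun i => l.getD i d

section Tape

variable {Γ : Type} (d : Γ)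

@[simp] theorem tapeOf_length (A : List Γ) (x : Γ) (B : List Γ) :
    tapeOf d (A ++ x :: B) A.length = x := by
  simp [tapeOf]

theorem update_tapeOf (A : List Γ) (x y : Γ) (B : List Γ) :
    Function.update (tapeOf d (A ++ x :: B)) A.length y = tapeOf d (A ++ y :: B) := by
  funext i
  rcases lt_trichotomy i A.length with h | rfl | h
  · rw [Function.update_of_ne h.ne]
    simp only [tapeOf]
    rw [List.getD_append _ _ _ _ h, List.getD_append _ _ _ _ h]
  · simp
  · rw [Function.update_of_ne h.ne']
    simp only [tapeOf]
    rw [List.getD_append_right _ _ _ _ h.le, List.getD_append_right _ _ _ _ h.le]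
    obtain ⟨k, hk⟩ : ∃ k, i - A.length = k + 1 := ⟨i - A.length - 1, by omega⟩
    rw [hk, List.getD_cons_succ, List.getD_cons_succ]

theorem tapeOf_append_default (A : List Γ) : tapeOf d (A ++ [d]) = tapeOf d A := by
  funext i
  simp only [tapeOf]
  rcases lt_or_ge i A.length with h | h
  · rw [List.getD_append _ _ _ _ h]
  · rw [List.getD_append_right _ _ _ _ h, List.getD_eq_default A d h]
    rcases i - A.length with _ | k <;> simp

end Tape

/-! ### Iterating a transducer by monotone writes -/

section Transducer

variable (Γ : Type) [PartialOrder Γ] [BoundedOrder Γ] (K : ℕ)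

/-- Lists of at most `K` symbols different from `⊥` and `⊤`. -/
def Output : Type := {l : List Γ // l.length ≤ K ∧ ∀ x ∈ l, x ≠ ⊥ ∧ x ≠ ⊤}

instance [Finite Γ] : Finite (Output Γ K) :=
  Set.Finite.subset (List.finite_length_le Γ K) fun _ h => h.1

/-- A finite-state transducer that is run again and again on its own output. At the end of its
input, it emits some more symbols and either begins the next run or stops with a verdict. -/
structure Transducer where
  State : Type
  [finite : Finite State]
  start : State
  read : State → Γ → State × Output Γ K
  flush : State → (State ⊕ Bool) × Output Γ K

variable {Γ K}

/-- The output of a transducer on an input, with the state or verdict after it. -/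
def Transducer.run (D : Transducer Γ K) (p : D.State) : List Γ → (D.State ⊕ Bool) × List Γ
  | [] => ((D.flush p).1, (D.flush p).2.1)
  | g :: u => ((D.run (D.read p g).1 u).1, (D.read p g).2.1 ++ (D.run (D.read p g).1 u).2)

variable (Γ K)

/-- States of the machine that runs a transducer repeatedly by a write-once strategy. -/
inductive SweepState (P : Type) : Type
  | read (r : P ⊕ Bool)
  | toSeparator (r : P ⊕ Bool) (o : Output Γ K)
  | toEnd (r : P ⊕ Bool) (o : Output Γ K) (last : Bool)
  | back (r : P ⊕ Bool) (last : Bool)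
  | toFront (r : P ⊕ Bool)

instance {P : Type} [Finite P] [Finite Γ] : Finite (SweepState Γ K P) :=
  Finite.of_injective (β := (P ⊕ Bool) ⊕ ((P ⊕ Bool) × Output Γ K) ⊕
      ((P ⊕ Bool) × Output Γ K × Bool) ⊕ ((P ⊕ Bool) × Bool) ⊕ (P ⊕ Bool))
    (fun s => match s with
      | .read r => .inl r
      | .toSeparator r o => .inr (.inl (r, o))
      | .toEnd r o b => .inr (.inr (.inl (r, o, b)))
      | .back r b => .inr (.inr (.inr (.inl (r, b))))
      | .toFront r => .inr (.inr (.inr (.inr r)))) (by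
    intro a b
    cases a <;> cases b <;> simp)

variable {Γ K}

open Classical in
/-- Transition function of the machine running a transducer. The tape consists of used cells `⊤`,
the rest of the current input, a separator `⊥`, and the output so far. -/
noncomputable def sweepTrans (D : Transducer Γ K) :
    SweepState Γ K D.State → Γ → SweepState Γ K D.State × Γ × Move
  | .read (.inl p), g =>
    if g = ⊥ then (.toEnd (D.flush p).1 (D.flush p).2 true, g, .right)
    else (.toSeparator (.inl (D.read p g).1) (D.read p g).2, ⊤, .right)
  | .read (.inr b), g => (.read (.inr b), g, .stay)
  | .toSeparator r o, g =>
    if g = ⊥ then (.toEnd r o false, g, .right) else (.toSeparator r o, g, .right)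
  | .toEnd r ⟨[], ho⟩ b, g =>
    if g = ⊥ then (.back r b, g, .left) else (.toEnd r ⟨[], ho⟩ b, g, .right)
  | .toEnd r ⟨x :: l, ho⟩ b, g =>
    if g = ⊥ then (.toEnd r ⟨l, (Nat.le_succ _).trans ho.1,
      fun y hy => ho.2 y (List.mem_cons_of_mem _ hy)⟩ b, x, .right)
    else (.toEnd r ⟨x :: l, ho⟩ b, g, .right)
  | .back r b, g =>
    -- The flag is set after the flush: the separator is then used up and the next run starts right
    -- behind it. Otherwise the current run goes on.
    if g = ⊥ then (if b then (.read r, ⊤, .right) else (.toFront r, g, .left))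
    else (.back r b, g, .left)
  | .toFront r, g => if g = ⊤ then (.read r, g, .right) else (.toFront r, g, .left)

/-- The machine running a transducer repeatedly by a write-once strategy. -/
noncomputable def Transducer.toTapeMachine [Finite Γ] (D : Transducer Γ K) : TapeMachine Γ :=
  haveI := D.finite
  { State := SweepState Γ K D.State
    trans := sweepTrans D
    start := .read (.inl D.start)
    accept := .read (.inr true)
    reject := .read (.inr false)
    accept_ne_reject := by simp }

variable [Finite Γ] (D : Transducer Γ K)

/-- A symbol is changed only by raising it to `⊤` or by writing over `⊥`. -/
theorem Transducer.le_trans_write (q : D.toTapeMachine.State) (g : Γ) :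
    g ≤ (D.toTapeMachine.trans q g).2.1 := by
  change g ≤ (sweepTrans D q g).2.1
  rcases q with (p | b) | ⟨r, o⟩ | ⟨r, ⟨_ | ⟨x, l⟩, ho⟩, b⟩ | ⟨r, b⟩ | r <;>
    simp only [sweepTrans] <;> (try split_ifs) <;>
      first | exact le_rfl | exact le_top | simp_all

/-- Configurations of the machine running a transducer. -/
noncomputable def Transducer.cfg (s : SweepState Γ K D.State) (h : ℕ) (l : List Γ) :
    D.toTapeMachine.Cfg where
  state := s
  head := h
  tape := tapeOf ⊥ l

/-- The states in which the machine has not halted. -/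
def SweepState.Active {P : Type} (s : SweepState Γ K P) : Prop :=
  s ≠ .read (.inr true) ∧ s ≠ .read (.inr false)

theorem Transducer.step_cfg (s : SweepState Γ K D.State) (hs : s.Active)
    (A : List Γ) (x : Γ) (B : List Γ) :
    D.toTapeMachine.step (D.cfg s A.length (A ++ x :: B)) =
      D.cfg (sweepTrans D s x).1 ((sweepTrans D s x).2.2.apply A.length)
        (A ++ (sweepTrans D s x).2.1 :: B) := by
  have h : D.toTapeMachine.step (D.cfg s A.length (A ++ x :: B)) =
      ⟨(sweepTrans D s (tapeOf ⊥ (A ++ x :: B) A.length)).1,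
        (sweepTrans D s (tapeOf ⊥ (A ++ x :: B) A.length)).2.2.apply A.length,
        Function.update (tapeOf ⊥ (A ++ x :: B)) A.length
          (sweepTrans D s (tapeOf ⊥ (A ++ x :: B) A.length)).2.1⟩ :=
    if_neg (by rintro (e | e); exacts [hs.1 e, hs.2 e])
  rw [h, tapeOf_length, update_tapeOf]
  rfl

/-- Makes the blank behind the list explicit when the head reaches it or when it is to act as a
separator, and removes it again. -/
theorem Transducer.cfg_append_bot (s : SweepState Γ K D.State) (h : ℕ) (l : List Γ) :
    D.cfg s h (l ++ [⊥]) = D.cfg s h l := by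
  simp only [Transducer.cfg, tapeOf_append_default]

theorem Transducer.reaches_right (s : SweepState Γ K D.State) (hs : s.Active) (B : List Γ)
    (hB : ∀ x ∈ B, sweepTrans D s x = (s, x, .right)) (A C : List Γ) :
    D.toTapeMachine.Reaches B.length (D.cfg s A.length (A ++ B ++ C))
      (D.cfg s (A ++ B).length (A ++ B ++ C)) := by
  induction B generalizing A with
  | nil => simpa using TapeMachine.Reaches.refl _
  | cons x B ih =>
    have h1 := D.step_cfg s hs A x (B ++ C)
    rw [hB x (by simp)] at h1
    have h2 := ih (fun y hy => hB y (by simp [hy])) (A ++ [x])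
    have := (TapeMachine.Reaches.single h1).trans (by simpa [Move.apply] using h2)
    simpa [Nat.add_comm, Nat.add_left_comm] using this

theorem Transducer.reaches_left (s : SweepState Γ K D.State) (hs : s.Active) (B : List Γ)
    (hB : ∀ x ∈ B, sweepTrans D s x = (s, x, .left)) (A : List Γ) (y : Γ) (C : List Γ) :
    D.toTapeMachine.Reaches B.length (D.cfg s (A.length + B.length) (A ++ y :: (B ++ C)))
      (D.cfg s A.length (A ++ y :: (B ++ C))) := by
  induction B using List.reverseRecOn generalizing C with
  | nil => simpa using TapeMachine.Reaches.refl _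
  | append_singleton B x ih =>
    have h1 := D.step_cfg s hs (A ++ y :: B) x C
    rw [hB x (by simp)] at h1
    have h2 := ih (fun y hy => hB y (by simp [hy])) (x :: C)
    have := (TapeMachine.Reaches.single h1).trans (by simpa [Move.apply] using h2)
    simpa [Nat.add_comm, Nat.add_left_comm] using this

/-- Symbols that may occur in the input or output of a transducer. -/
def Proper (l : List Γ) : Prop := ∀ x ∈ l, x ≠ ⊥ ∧ x ≠ ⊤

theorem Transducer.reaches_emit (r : D.State ⊕ Bool) (b : Bool) (A : List Γ) (l : List Γ)
    (hl : l.length ≤ K ∧ Proper l) :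
    D.toTapeMachine.Reaches (l.length + 1) (D.cfg (.toEnd r ⟨l, hl⟩ b) A.length A)
      (D.cfg (.back r b) ((A ++ l).length - 1) (A ++ l)) := by
  induction l generalizing A with
  | nil =>
    rw [← D.cfg_append_bot _ _ A]
    refine TapeMachine.Reaches.single ?_
    rw [D.step_cfg _ ⟨by simp, by simp⟩]
    simp [sweepTrans, Move.apply, D.cfg_append_bot]
  | cons x l ih =>
    have h1 := D.step_cfg (.toEnd r ⟨x :: l, hl⟩ b) ⟨by simp, by simp⟩ A ⊥ []
    rw [D.cfg_append_bot] at h1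
    have h2 := ih (A ++ [x]) ⟨(Nat.le_succ _).trans hl.1,
      fun y hy => hl.2 y (List.mem_cons_of_mem _ hy)⟩
    have := (TapeMachine.Reaches.single h1).trans (by simpa [Move.apply, sweepTrans] using h2)
    simpa [Nat.add_comm, Nat.add_left_comm] using this

/-- Starting behind the separator, the machine appends a list and returns to the separator. -/
theorem Transducer.reaches_append (r : D.State ⊕ Bool) (b : Bool) (A v : List Γ) (hv : Proper v)
    (o : Output Γ K) :
    D.toTapeMachine.Reaches (2 * v.length + 2 * K + 1)
      (D.cfg (.toEnd r o b) (A.length + 1) (A ++ ⊥ :: v))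
      (D.cfg (.back r b) A.length (A ++ ⊥ :: (v ++ o.1))) := by
  obtain ⟨l, hl⟩ := o
  have h1 := D.reaches_right (.toEnd r ⟨l, hl⟩ b) ⟨by simp, by simp⟩ v (by
    intro x hx
    cases l <;> simp [sweepTrans, (hv x hx).1]) (A ++ [⊥]) []
  have h2 := D.reaches_emit r b (A ++ [⊥] ++ v) l hl
  have h3 := D.reaches_left (.back r b) ⟨by simp, by simp⟩ (v ++ l) (by
    intro x hx
    have : x ≠ ⊥ := by
      rcases List.mem_append.1 hx with hx | hx
      exacts [(hv x hx).1, (hl.2 x hx).1]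
    simp [sweepTrans, this]) A ⊥ []
  have h12 := h1.trans (by simpa using h2)
  have e : (A ++ [⊥] ++ v ++ l).length - 1 = A.length + (v ++ l).length := by simp
  simp only [List.append_assoc, List.singleton_append, List.append_nil, List.length_append,
    List.length_cons, List.length_nil] at h1 h2 h3 h12 e ⊢
  refine (h12.trans ?_).mono (s := v.length + (l.length + 1) + (v.length + l.length)) ?_
  · convert h3 using 2
  · have := hl.1
    omega

/-- The way back ends at the `⊤` just written, because `u` contains no `⊤`. Hence the cost does not
depend on the number `i` of used blocks. -/
theorem Transducer.reaches_read (p : D.State) (i : ℕ) (g : Γ) (hg : g ≠ ⊥ ∧ g ≠ ⊤)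
    (u v : List Γ) (hu : Proper u) (hv : Proper v) :
    D.toTapeMachine.Reaches (2 * (u.length + v.length + K) + 6)
      (D.cfg (.read (.inl p)) i (List.replicate i ⊤ ++ g :: (u ++ ⊥ :: v)))
      (D.cfg (.read (.inl (D.read p g).1)) (i + 1)
        (List.replicate (i + 1) ⊤ ++ (u ++ ⊥ :: (v ++ (D.read p g).2.1)))) := by
  set r : D.State ⊕ Bool := .inl (D.read p g).1 with hr
  set o := (D.read p g).2 with ho
  set A : List Γ := List.replicate i ⊤ with hA
  have hAl : A.length = i := by simp [hA]
  have hA1 : List.replicate (i + 1) (⊤ : Γ) = A ++ [⊤] := List.replicate_succ'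
  have h1 := D.step_cfg (.read (.inl p)) ⟨by simp, by simp⟩ A g (u ++ ⊥ :: v)
  simp only [sweepTrans, if_neg hg.1, Move.apply, ← ho, ← hr] at h1
  have h2 := D.reaches_right (.toSeparator r o) ⟨by simp, by simp⟩ u (by
    intro x hx; simp [sweepTrans, (hu x hx).1]) (A ++ [⊤]) (⊥ :: v)
  have h3 := D.step_cfg (.toSeparator r o) ⟨by simp, by simp⟩ (A ++ [⊤] ++ u) ⊥ v
  simp only [sweepTrans, if_true, Move.apply] at h3
  have h4 := D.reaches_append r false (A ++ [⊤] ++ u) v hv o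
  have h5 := D.step_cfg (.back r false) ⟨by simp, by simp⟩ (A ++ [⊤] ++ u) ⊥ (v ++ o.1)
  simp only [sweepTrans, if_true, Move.apply, Bool.false_eq_true, if_false] at h5
  have h6 := D.reaches_left (.toFront r) ⟨by simp, by simp⟩ u (by
    intro x hx; simp [sweepTrans, (hu x hx).2]) A ⊤ (⊥ :: (v ++ o.1))
  have h7 := D.step_cfg (.toFront r) ⟨by simp, by simp⟩ A ⊤ (u ++ ⊥ :: (v ++ o.1))
  simp only [sweepTrans, if_true, Move.apply] at h7
  have e : (A ++ [⊤] ++ u).length - 1 = A.length + u.length := by simp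
  rw [e] at h5
  simp only [List.append_assoc, List.singleton_append, List.length_append, List.length_cons,
    List.length_nil, hA1, hAl, zero_add] at h1 h2 h3 h4 h5 h6 h7 ⊢
  have := (TapeMachine.Reaches.single h1).trans <| h2.trans <|
    (TapeMachine.Reaches.single h3).trans <| h4.trans <| (TapeMachine.Reaches.single h5).trans <|
    h6.trans <| TapeMachine.Reaches.single h7
  exact this.mono (by omega)

theorem Transducer.reaches_flush (p : D.State) (i : ℕ)
    (v : List Γ) (hv : Proper v) :
    D.toTapeMachine.Reaches (2 * (v.length + K) + 6)
      (D.cfg (.read (.inl p)) i (List.replicate i ⊤ ++ ⊥ :: v))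
      (D.cfg (.read (D.flush p).1) (i + 1)
        (List.replicate (i + 1) ⊤ ++ (v ++ (D.flush p).2.1))) := by
  set A : List Γ := List.replicate i ⊤ with hA
  have hAl : A.length = i := by simp [hA]
  have hA1 : List.replicate (i + 1) (⊤ : Γ) = A ++ [⊤] := List.replicate_succ'
  have h1 := D.step_cfg (.read (.inl p)) ⟨by simp, by simp⟩ A ⊥ v
  simp only [sweepTrans, if_true, Move.apply] at h1
  have h2 := D.reaches_append (D.flush p).1 true A v hv (D.flush p).2
  have h3 := D.step_cfg (.back (D.flush p).1 true) ⟨by simp, by simp⟩ A ⊥ (v ++ (D.flush p).2.1)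
  simp only [sweepTrans, if_true, Move.apply] at h3
  have := (TapeMachine.Reaches.single h1).trans <| h2.trans <| TapeMachine.Reaches.single h3
  rw [hAl] at this
  simp only [hA1, List.append_assoc, List.singleton_append]
  exact this.mono (by omega)

/-- There are `u.length + 1` rounds including the flush, and each appends at most `K` symbols, which
bounds the output to be crossed in any round. -/
theorem Transducer.reaches_run (p : D.State) (i : ℕ) (u v : List Γ)
    (hu : Proper u) (hv : Proper v) :
    D.toTapeMachine.Reaches ((u.length + 1) * (2 * (u.length + 1) + 2 * (v.length +
        K * (u.length + 1)) + 6))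
      (D.cfg (.read (.inl p)) i (List.replicate i ⊤ ++ (u ++ ⊥ :: v)))
      (D.cfg (.read (D.run p u).1) (i + u.length + 1)
        (List.replicate (i + u.length + 1) ⊤ ++ (v ++ (D.run p u).2))) := by
  induction u generalizing p i v with
  | nil =>
    refine (D.reaches_flush p i v hv).mono ?_
    simp only [List.length_nil]
    omega
  | cons g u ih =>
    have hu' : Proper u := fun x hx => hu x (List.mem_cons_of_mem _ hx)
    have h1 := D.reaches_read p i g (hu g (by simp)) u v hu' hv
    have h2 := ih (D.read p g).1 (i + 1) (v ++ (D.read p g).2.1) hu' (by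
      intro x hx
      rcases List.mem_append.1 hx with hx | hx
      exacts [hv x hx, (D.read p g).2.2.2 x hx])
    have h3 := h1.trans h2
    have e : i + 1 + u.length + 1 = i + (u.length + 1) + 1 := by omega
    simp only [List.append_assoc, List.length_append, e] at h3
    refine TapeMachine.Reaches.mono h3 ?_
    have ho := (D.read p g).2.2.1
    simp only [List.length_cons]
    nlinarith [Nat.mul_le_mul_left (u.length + 1) ho]

end Transducer

/-! ### One step of a machine as a pass over its configuration -/

/-- A cell of a tape together with the information whether the head is on it. -/
abbrev Cell : Type := Bool × Bool

/-- State of a pass over the cells of a configuration: the state of the machine, whether the head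
is to be placed on the next cell, and the last cell read, which is not yet emitted. -/
abbrev PassState (M : Machine) : Type := M.State × Bool × Option Cell

section Pass

variable (M : Machine)

/-- One step of the pass that replaces a configuration by its successor. -/
def passStep : PassState M → Cell → PassState M × List Cell
  | (q, true, p), (_, x) => ((q, false, some (true, x)), p.toList)
  | (q, false, p), (false, x) => ((q, false, some (false, x)), p.toList)
  | (q, false, p), (true, x) =>
    match (M.trans q x).2.2, p with
    -- The delay by one cell serves this case: the left neighbour is still pending and can receive
    -- the head mark. With nothing pending, the head is on the first cell and stays there.
    | .left, some c => (((M.trans q x).1, false, some (false, (M.trans q x).2.1)), [(true, c.2)])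
    | .left, none => (((M.trans q x).1, false, some (true, (M.trans q x).2.1)), [])
    | .stay, p => (((M.trans q x).1, false, some (true, (M.trans q x).2.1)), p.toList)
    | .right, p => (((M.trans q x).1, true, some (false, (M.trans q x).2.1)), p.toList)

/-- What the pass emits at the end. -/
def passEnd (s : PassState M) : List Cell :=
  s.2.2.toList ++ if s.2.1 then [(true, false)] else []

/-- The pass over a list of cells, without its end. -/
def passFold (s : PassState M) : List Cell → PassState M × List Cell
  | [] => (s, [])
  | c :: l => ((passFold (passStep M s c).1 l).1,
      (passStep M s c).2 ++ (passFold (passStep M s c).1 l).2)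

/-- The pass over a list of cells: the resulting state of the machine and the cells emitted. -/
def pass (s : PassState M) (l : List Cell) : M.State × List Cell :=
  ((passFold M s l).1.1, (passFold M s l).2 ++ passEnd M (passFold M s l).1)

variable {M}

@[simp] theorem pass_nil (s : PassState M) : pass M s [] = (s.1, passEnd M s) := rfl

@[simp] theorem pass_cons (s : PassState M) (c : Cell) (l : List Cell) :
    pass M s (c :: l) = ((pass M (passStep M s c).1 l).1,
      (passStep M s c).2 ++ (pass M (passStep M s c).1 l).2) := by
  simp [pass, passFold]

theorem pass_append (s : PassState M) (l l' : List Cell) :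
    pass M s (l ++ l') = ((pass M (passFold M s l).1 l').1,
      (passFold M s l).2 ++ (pass M (passFold M s l).1 l').2) := by
  induction l generalizing s with
  | nil => simp [passFold]
  | cons c l ih => simp [passFold, ih]

theorem passStep_length (s : PassState M) (c : Cell) : (passStep M s c).2.length ≤ 1 := by
  have h (p : Option Cell) : p.toList.length ≤ 1 := by cases p <;> simp
  obtain ⟨q, b, p⟩ := s
  obtain ⟨f, x⟩ := c
  rcases b with _ | _ <;> rcases f with _ | _ <;> simp only [passStep, h]
  split <;> simp [h]

theorem passFold_length (s : PassState M) (l : List Cell) :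
    (passFold M s l).2.length ≤ l.length := by
  induction l generalizing s with
  | nil => simp [passFold]
  | cons c l ih =>
    have := passStep_length s c
    have := ih (passStep M s c).1
    simp only [passFold, List.length_append, List.length_cons]
    omega

theorem passEnd_length (s : PassState M) : (passEnd M s).length ≤ 2 := by
  obtain ⟨q, b, p⟩ := s
  cases b <;> cases p <;> simp [passEnd]

/-- The cells of a configuration with `L` to the left of the head, `x` under it, and `R` to the
right of it. -/
def cells (L : List Bool) (x : Bool) (R : List Bool) : List Cell :=
  L.map (Prod.mk false) ++ (true, x) :: R.map (Prod.mk false)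

theorem pass_some_unmarked (q : M.State) (c : Cell) (R : List Bool) :
    pass M (q, false, some c) (R.map (Prod.mk false)) = (q, c :: R.map (Prod.mk false)) := by
  induction R generalizing c with
  | nil => simp [passEnd]
  | cons x R ih => simp [passStep, ih]

theorem passFold_unmarked (q : M.State) (p : Option Cell) (L : List Bool) (x : Bool) :
    passFold M (q, false, p) ((L ++ [x]).map (Prod.mk false)) =
      ((q, false, some (false, x)), p.toList ++ L.map (Prod.mk false)) := by
  induction L generalizing p with
  | nil => simp [passFold, passStep]
  | cons y L ih =>
    have := ih (some (false, y))
    simp only [List.cons_append, List.map_cons, passFold, passStep]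
    rw [this]
    simp

/-- Serves both for moves to the right and for the preliminary pass, which places the head on the
first input cell. If no cell is left, `passEnd` creates a blank one under the head. -/
theorem pass_carry (q : M.State) (p : Option Cell) (R : List Bool) :
    pass M (q, true, p) (R.map (Prod.mk false)) =
      (q, p.toList ++ cells [] (R.headD false) R.tail) := by
  rcases R with _ | ⟨x, R⟩
  · simp [passEnd, cells]
  · simp [passStep, cells, pass_some_unmarked]

/-- Configuration given by the two parts of a tape. -/
def Machine.zip (M : Machine) (q : M.State) (L : List Bool) (x : Bool) (R : List Bool) : M.Cfg where
  state := q
  head := L.length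
  tape := tapeOf false (L ++ x :: R)

theorem tapeOf_cons_head_tail (A R : List Bool) :
    tapeOf false (A ++ R.headD false :: R.tail) = tapeOf false (A ++ R) := by
  rcases R with _ | ⟨x, R⟩
  · simpa using tapeOf_append_default false A
  · rfl

/-- The length grows only when the head moves right from the last listed cell. -/
theorem exists_pass_eq_step (q : M.State) (hq : ¬ (q = M.accept ∨ q = M.reject))
    (L : List Bool) (x : Bool) (R : List Bool) :
    ∃ q' L' x' R', M.step (M.zip q L x R) = M.zip q' L' x' R' ∧
      pass M (q, false, none) (cells L x R) = (q', cells L' x' R') ∧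
      (cells L' x' R').length ≤ (cells L x R).length + 1 := by
  have hstep : M.step (M.zip q L x R) = ⟨(M.trans q x).1, (M.trans q x).2.2.apply L.length,
      tapeOf false (L ++ (M.trans q x).2.1 :: R)⟩ := by
    have : M.step (M.zip q L x R) = ⟨(M.trans q (tapeOf false (L ++ x :: R) L.length)).1,
        (M.trans q (tapeOf false (L ++ x :: R) L.length)).2.2.apply L.length,
        Function.update (tapeOf false (L ++ x :: R)) L.length
          (M.trans q (tapeOf false (L ++ x :: R) L.length)).2.1⟩ := if_neg hq
    rw [this, tapeOf_length, update_tapeOf]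
  rw [hstep]
  rcases hT : M.trans q x with ⟨q', b, mv⟩
  have right (A : List Bool) :
      tapeOf false (A ++ b :: R) = tapeOf false ((A ++ [b]) ++ R.headD false :: R.tail) := by
    rw [tapeOf_cons_head_tail, List.append_assoc, List.singleton_append]
  have length : R.tail.length ≤ R.length := by simp
  rcases L.eq_nil_or_concat' with rfl | ⟨L, y, rfl⟩
  · cases mv
    · refine ⟨q', [], b, R, rfl, ?_, by simp [cells]⟩
      simp [cells, passStep, hT, pass_some_unmarked]
    · refine ⟨q', [], b, R, rfl, ?_, by simp [cells]⟩
      simp [cells, passStep, hT, pass_some_unmarked]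
    · refine ⟨q', [b], R.headD false, R.tail, ?_, ?_, by simp [cells]⟩
      · simp only [right, Machine.zip]
        rfl
      · simp [cells, passStep, hT, pass_carry]
  · cases mv
    · refine ⟨q', L, y, b :: R, ?_, ?_, by simp [cells]⟩
      · simp [Machine.zip, Move.apply]
      · rw [cells, pass_append, passFold_unmarked]
        simp [cells, passStep, hT, pass_some_unmarked]
    · refine ⟨q', L ++ [y], b, R, rfl, ?_, by simp [cells]⟩
      rw [cells, pass_append, passFold_unmarked]
      simp [cells, passStep, hT, pass_some_unmarked]
    · refine ⟨q', L ++ [y] ++ [b], R.headD false, R.tail, ?_, ?_, by simp [cells]; omega⟩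
      · simp only [right, Machine.zip, Move.apply, List.length_append, List.length_singleton]
      · rw [cells, pass_append, passFold_unmarked]
        simp [cells, passStep, hT, pass_carry]

end Pass

/-! ### Simulating a machine by a transducer over blocks -/

/-- The block holding one marked or unmarked bit. -/
def bitBlock {m : ℕ} (b : Bool) : Fin (m + 2) → Bool := fun j => if j = 0 then b else !b

/-- The first two bits of the block differ; this needs width at least two. -/
theorem bitBlock_proper {m : ℕ} (b : Bool) :
    (bitBlock b : Fin (m + 2) → Bool) ≠ ⊥ ∧ (bitBlock b : Fin (m + 2) → Bool) ≠ ⊤ := by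
  constructor <;> intro h <;> have h0 := congrFun h 0 <;> have h1 := congrFun h 1 <;>
    cases b <;> simp [bitBlock] at h0 h1

/-- A list of cells written in blocks. -/
def encodeCells (m : ℕ) : List Cell → List (Fin (m + 2) → Bool)
  | [] => []
  | c :: l => bitBlock c.1 :: bitBlock c.2 :: encodeCells m l

theorem encodeCells_append (m : ℕ) (l l' : List Cell) :
    encodeCells m (l ++ l') = encodeCells m l ++ encodeCells m l' := by
  induction l with
  | nil => rfl
  | cons c l ih => simp [encodeCells, ih]

theorem encodeCells_length (m : ℕ) (l : List Cell) :
    (encodeCells m l).length = 2 * l.length := by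
  induction l with
  | nil => rfl
  | cons c l ih => simp [encodeCells, ih]; ring

theorem encodeCells_proper (m : ℕ) (l : List Cell) : Proper (encodeCells m l) := by
  induction l with
  | nil => simp [Proper, encodeCells]
  | cons c l ih =>
    intro x hx
    simp only [encodeCells, List.mem_cons] at hx
    rcases hx with rfl | rfl | hx
    exacts [bitBlock_proper _, bitBlock_proper _, ih x hx]

/-- At most `m + 2` cells as an output of a transducer. -/
def outputCells (m : ℕ) (l : List Cell) (h : l.length ≤ m + 2) :
    Output (Fin (m + 2) → Bool) (2 * (m + 2)) :=
  ⟨encodeCells m l, by rw [encodeCells_length]; omega, encodeCells_proper m l⟩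

section Simulate

variable (M : Machine) (m : ℕ)

/-- The state of the transducer at the beginning of a run, or the verdict. -/
def verdict (q : M.State) : (PassState M × Option (Option Bool)) ⊕ Bool :=
  if q = M.accept then .inr true else if q = M.reject then .inr false
  else .inl ((q, false, none), some none)

/-- The bits of a block as cells without the head. -/
def blockCells {m : ℕ} (g : Fin (m + 2) → Bool) : List Cell := (List.ofFn g).map (Prod.mk false)

/-- The transducer whose runs simulate the steps of `M`. The first run, in phase `none`, reads
blocks of tape cells; the others read encoded cells, and are in phase `some none` or `some (some f)`
according to whether the head mark `f` of the next cell has already been read. -/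
def Machine.toTransducer : Transducer (Fin (m + 2) → Bool) (2 * (m + 2)) where
  State := PassState M × Option (Option Bool)
  start := ((M.start, true, none), none)
  read
    | (s, none), g => (((passFold M s (blockCells g)).1, none),
        outputCells m (passFold M s (blockCells g)).2
          ((passFold_length _ _).trans (by simp [blockCells])))
    | (s, some none), g => ((s, some (some (g 0))), outputCells m [] (by simp))
    | (s, some (some f)), g => (((passStep M s (f, g 0)).1, some none),
        outputCells m (passStep M s (f, g 0)).2 ((passStep_length _ _).trans (by omega)))
  flush | (s, _) => (verdict M s.1, outputCells m (passEnd M s)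
      ((passEnd_length _).trans (by omega)))

theorem toTransducer_run_encodeCells (s : PassState M) (l : List Cell) :
    (M.toTransducer m).run (s, some none) (encodeCells m l) =
      (verdict M (pass M s l).1, encodeCells m (pass M s l).2) := by
  induction l generalizing s with
  | nil => rfl
  | cons c l ih =>
    have h : ∀ b : Bool, (bitBlock b : Fin (m + 2) → Bool) 0 = b := fun b => by simp [bitBlock]
    simp only [encodeCells, Transducer.run, pass_cons, encodeCells_append]
    simp only [Machine.toTransducer, h]
    have := ih (passStep M s c).1
    simp only [Machine.toTransducer] at this
    rw [this]
    simp [outputCells, encodeCells]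

theorem toTransducer_run_blocks (s : PassState M) (l : List (Fin (m + 2) → Bool)) :
    (M.toTransducer m).run (s, none) l =
      (verdict M (pass M s (l.flatMap blockCells)).1,
        encodeCells m (pass M s (l.flatMap blockCells)).2) := by
  induction l generalizing s with
  | nil => rfl
  | cons g l ih =>
    simp only [List.flatMap_cons, Transducer.run, pass_append, encodeCells_append]
    have := ih (passFold M s (blockCells g)).1
    simp only [Machine.toTransducer] at this ⊢
    rw [this]
    simp [outputCells]

end Simulate

section Simulate

variable (M : Machine) (m : ℕ)

theorem verdict_of_halted {q : M.State} {b : Bool} (h : q = if b then M.accept else M.reject) :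
    verdict M q = .inr b := by
  subst h
  cases b <;> simp [verdict, M.accept_ne_reject.symm]

theorem verdict_of_not_halted {q : M.State} (h : ¬ (q = M.accept ∨ q = M.reject)) :
    verdict M q = .inl ((q, false, none), some none) := by
  simp [verdict, not_or.1 h]

/-- The `0` is the length of the output at the beginning of a run. -/
theorem runCost_le (K l : ℕ) : (l + 1) * (2 * (l + 1) + 2 * (0 + K * (l + 1)) + 6) ≤
    (2 * K + 8) * (l + 1) ^ 2 := by
  nlinarith [Nat.zero_le l]

/-- A configuration at the beginning of a run of the transducer. -/
noncomputable def runCfg (q : M.State) (i : ℕ) (l : List Cell) :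
    (M.toTransducer m).toTapeMachine.Cfg :=
  (M.toTransducer m).cfg (.read (verdict M q)) i (List.replicate i ⊤ ++ encodeCells m l)

/-- `N` bounds the lengths of all configurations to come, as each step adds at most one cell. A cell
takes two blocks, whence `2 * N + 1`, and `4 * m + 16` is `2 * K + 8` for `K = 2 * (m + 2)`. -/
theorem reaches_verdict (s N : ℕ) (b : Bool) (q : M.State) (L : List Bool) (x : Bool)
    (R : List Bool) (i : ℕ) (hN : (cells L x R).length + s ≤ N)
    (h : (M.step^[s] (M.zip q L x R)).state = if b then M.accept else M.reject) :
    ∃ j l, (M.toTransducer m).toTapeMachine.Reaches (s * ((4 * m + 16) * (2 * N + 1) ^ 2))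
      (runCfg M m q i (cells L x R)) ((M.toTransducer m).cfg (.read (.inr b)) j l) := by
  induction s generalizing q L x R i with
  | zero =>
    refine ⟨i, List.replicate i ⊤ ++ encodeCells m (cells L x R), ?_⟩
    rw [runCfg, verdict_of_halted M (q := q) h, Nat.zero_mul]
    exact .refl _
  | succ s ih =>
    by_cases hq : q = M.accept ∨ q = M.reject
    · rw [Machine.iterate_step_of_halted (c := M.zip q L x R) hq] at h
      refine ⟨i, List.replicate i ⊤ ++ encodeCells m (cells L x R), ?_⟩
      rw [runCfg, verdict_of_halted M (q := q) h]
      exact (TapeMachine.Reaches.refl _).mono (Nat.zero_le _)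
    · obtain ⟨q', L', x', R', hstep, hpass, hlen⟩ := exists_pass_eq_step q hq L x R
      rw [Function.iterate_succ_apply, hstep] at h
      have h1 := (M.toTransducer m).reaches_run ((q, false, none), some none) i
        (encodeCells m (cells L x R)) [] (encodeCells_proper m _) (by simp [Proper])
      rw [toTransducer_run_encodeCells, hpass, ← List.append_assoc,
        Transducer.cfg_append_bot] at h1
      obtain ⟨j, l, h2⟩ := ih q' L' x' R' (i + (encodeCells m (cells L x R)).length + 1)
        (by omega) h
      refine ⟨j, l, ?_⟩
      rw [runCfg, verdict_of_not_halted M hq]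
      refine (h1.trans h2).mono ?_
      have h3 := runCost_le (2 * (m + 2)) (encodeCells m (cells L x R)).length
      have h4 : (2 * (2 * (m + 2)) + 8) * ((encodeCells m (cells L x R)).length + 1) ^ 2 ≤
          (4 * m + 16) * (2 * N + 1) ^ 2 := by
        rw [encodeCells_length, show 2 * (2 * (m + 2)) + 8 = 4 * m + 16 by ring]
        exact Nat.mul_le_mul_left _ (Nat.pow_le_pow_left (by omega) 2)
      rw [List.length_nil]
      linarith

end Simulate

/-! ### Input words and the write-once machine -/

section Input

variable {α : Type*} (c : BlockCode α) (m : ℕ)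

/-- The block of a letter. -/
def BlockCode.block (a : α) : Fin (m + 2) → Bool := fun j => (c.code a).getD j false

variable {m}

theorem BlockCode.ofFn_block (a : α) (hm : (c.code a).length = m + 2) :
    List.ofFn (c.block m a) = c.code a := by
  apply List.ext_getElem
  · simp [hm]
  · intro i h1 h2
    rw [List.getElem_ofFn, BlockCode.block, List.getD_eq_getElem _ _ h2]

theorem BlockCode.block_proper (a : α) (hm : (c.code a).length = m + 2) :
    c.block m a ≠ ⊥ ∧ c.block m a ≠ ⊤ := by
  have ht := c.exists_marked a
  have hf := c.exists_blank a
  rw [← c.ofFn_block a hm, List.mem_ofFn] at ht hf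
  obtain ⟨i, hi⟩ := ht
  obtain ⟨j, hj⟩ := hf
  constructor <;> intro h
  · simp [h] at hi
  · simp [h] at hj

theorem unblock_blocks (hm : ∀ a, (c.code a).length = m + 2) (w : List α) :
    unblock (tapeOf ⊥ (w.map (c.block m))) = c.inputTape w := by
  induction w with
  | nil => funext i; simp [unblock, tapeOf, BlockCode.inputTape]
  | cons a w ih =>
    funext i
    have hi := congrFun ih (i - (m + 2))
    simp only [unblock, tapeOf, BlockCode.inputTape, List.map_cons, List.flatMap_cons] at hi ⊢
    rcases lt_or_ge i (m + 2) with h | h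
    · rw [List.getD_append _ _ _ _ (by rw [hm]; exact h), Nat.div_eq_of_lt h, List.getD_cons_zero]
      simp [BlockCode.block, Nat.mod_eq_of_lt h]
    · rw [List.getD_append_right _ _ _ _ (by rw [hm]; exact h), hm, ← hi]
      obtain ⟨k, rfl⟩ := Nat.exists_eq_add_of_le h
      have h1 : (m + 2 + k) / (m + 1 + 1) = k / (m + 1 + 1) + 1 := by
        rw [show m + 2 + k = k + (m + 1 + 1) by ring, Nat.add_div_right _ (by omega)]
      have h2 : Fin.ofNat (m + 1 + 1) (m + 2 + k) = Fin.ofNat (m + 1 + 1) k :=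
        Fin.ext (by simp)
      rw [h1, h2, List.getD_cons_succ, Nat.add_sub_cancel_left]

theorem flatMap_blockCells (hm : ∀ a, (c.code a).length = m + 2) (w : List α) :
    (w.map (c.block m)).flatMap blockCells = (w.flatMap c.code).map (Prod.mk false) := by
  induction w with
  | nil => rfl
  | cons a w ih =>
    rw [List.map_cons, List.flatMap_cons, ih, blockCells, c.ofFn_block a (hm a), List.flatMap_cons,
      List.map_append]

theorem length_flatMap_code (hm : ∀ a, (c.code a).length = m + 2) (w : List α) :
    (w.flatMap c.code).length = (m + 2) * w.length := by
  induction w with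
  | nil => rfl
  | cons a w ih => simp [ih, hm]; ring

variable (M : Machine)

/-- The write-once machine simulating `M`. -/
noncomputable def Machine.writeOnce (M : Machine) (m : ℕ) : Machine :=
  (M.toTransducer m).toTapeMachine.toMachine

/-- The first summand pays for the preliminary pass over the letter blocks. The `+ 1` in the length
bound covers the empty word, whose configuration still has the cell under the head. -/
theorem exists_verdict (hm : ∀ a, (c.code a).length = m + 2) (w : List α) (s : ℕ) (b : Bool)
    (h : (M.step^[s] (M.init c w)).state = if b then M.accept else M.reject) :
    ∃ j l, (M.toTransducer m).toTapeMachine.Reaches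
      ((4 * m + 16) * (w.length + 1) ^ 2 +
        s * ((4 * m + 16) * (2 * ((m + 2) * w.length + 1 + s) + 1) ^ 2))
      ((M.toTransducer m).cfg (.read (.inl (M.toTransducer m).start)) 0 (w.map (c.block m)))
      ((M.toTransducer m).cfg (.read (.inr b)) j l) := by
  have h1 := (M.toTransducer m).reaches_run (M.toTransducer m).start 0 (w.map (c.block m)) []
    (by
      intro x hx
      obtain ⟨a, -, rfl⟩ := List.mem_map.1 hx
      exact c.block_proper a (hm a)) (by simp [Proper])
  have hrun : (M.toTransducer m).run (M.toTransducer m).start (w.map (c.block m)) = _ :=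
    toTransducer_run_blocks M m (M.start, true, none) _
  rw [hrun, flatMap_blockCells c hm, pass_carry, ← List.append_assoc,
    Transducer.cfg_append_bot] at h1
  have hinit : M.init c w = M.zip M.start [] ((w.flatMap c.code).headD false)
      (w.flatMap c.code).tail := by
    simp only [Machine.zip, tapeOf_cons_head_tail]
    rfl
  rw [hinit] at h
  obtain ⟨j, l, h2⟩ := reaches_verdict M m s ((m + 2) * w.length + 1 + s) b _ _ _ _
    (0 + (w.map (c.block m)).length + 1) (by
      simp only [cells, List.map_nil, List.nil_append, List.length_cons, List.length_map,
        List.length_tail, length_flatMap_code c hm]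
      omega) h
  refine ⟨j, l, (h1.trans h2).mono (Nat.add_le_add_right ?_ _)⟩
  have h3 := runCost_le (2 * (m + 2)) w.length
  rw [show 2 * (2 * (m + 2)) + 8 = 4 * m + 16 by ring] at h3
  simpa using h3

theorem Machine.writeOnce_isWriteOnce : (M.writeOnce m).IsWriteOnce :=
  TapeMachine.toMachine_isWriteOnce _

theorem Machine.writeOnce_decides (hm : ∀ a, (c.code a).length = m + 2) {L : Language α}
    {T : ℕ → ℕ}    (h : M.DecidesInTime c L T) :
    (M.writeOnce m).DecidesInTime c L fun n => 3 * (m + 1 + 1) * ((4 * m + 16) * (n + 1) ^ 2 +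
        T n * ((4 * m + 16) * (2 * ((m + 2) * n + 1 + T n) + 1) ^ 2)) := by
  intro w
  obtain ⟨s, hs, hacc, hrej⟩ := h w
  have key (b : Bool) (hb : (M.step^[s] (M.init c w)).state = if b then M.accept else M.reject) :
      ∃ k ≤ 3 * (m + 1 + 1) * ((4 * m + 16) * (w.length + 1) ^ 2 +
        T w.length * ((4 * m + 16) * (2 * ((m + 2) * w.length + 1 + T w.length) + 1) ^ 2)),
      ((M.writeOnce m).step^[k] ((M.writeOnce m).init c w)).state =
        if b then (M.writeOnce m).accept else (M.writeOnce m).reject := by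
    obtain ⟨j, l, k, hk, e⟩ := exists_verdict c M hm w s b hb
    refine ⟨3 * (m + 1 + 1) * k, Nat.mul_le_mul_left _ (hk.trans ?_), ?_⟩
    · gcongr
    · have hsim := toMachine_iterate (M.toTransducer m).toTapeMachine
        (M.toTransducer m).le_trans_write k ((M.toTransducer m).cfg
          (.read (.inl (M.toTransducer m).start)) 0 (w.map (c.block m)))
      rw [e] at hsim
      have hi : (M.writeOnce m).init c w = ((M.toTransducer m).cfg
          (.read (.inl (M.toTransducer m).start)) 0 (w.map (c.block m))).unblock := by
        simp only [TapeMachine.Cfg.unblock, Transducer.cfg, unblock_blocks c hm, Nat.zero_mul]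
        rfl
      rw [hi]
      refine (congrArg Machine.Cfg.state hsim).trans ?_
      cases b <;> rfl
  by_cases hw : w ∈ L
  · obtain ⟨k, hk, e⟩ := key true (by simpa using hacc hw)
    exact ⟨k, hk, fun _ => by simpa using e, fun h => absurd hw h⟩
  · obtain ⟨k, hk, e⟩ := key false (by simpa using hrej hw)
    exact ⟨k, hk, fun h => absurd h hw, fun _ => by simpa using e⟩

/-- A block with a marked and a blank cell has at least two cells; over the empty alphabet any `m`
will do. -/
theorem BlockCode.exists_width : ∃ m, ∀ a, (c.code a).length = m + 2 := by
  by_cases hα : Nonempty α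
  · obtain ⟨a⟩ := hα
    have h2 : 2 ≤ c.width := by
      rw [← c.length_code a]
      have ht := c.exists_marked a
      have hf := c.exists_blank a
      rcases hl : c.code a with _ | ⟨x, _ | ⟨y, l⟩⟩
      · simp [hl] at ht
      · simp only [hl, List.mem_singleton] at ht hf
        exact absurd (ht.trans hf.symm) (by simp)
      · simp
    exact ⟨c.width - 2, fun b => by rw [c.length_code]; omega⟩
  · exact ⟨0, fun a => absurd ⟨a⟩ hα⟩

end Input

/-! ### Absorbing the cubic overhead -/

section Bounds

theorem le_kexp (k x : ℕ) : x ≤ kexp k x := by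
  induction k with
  | zero => exact le_rfl
  | succ k ih => exact ih.trans Nat.lt_two_pow_self.le

theorem kexp_mono (k : ℕ) : Monotone (kexp k) := by
  induction k with
  | zero => exact monotone_id
  | succ k ih => exact fun x y h => Nat.pow_le_pow_right two_pos (ih h)

/-- Cubing a power of two triples its exponent `Y`, and `3 * Y ≤ Y ^ 3` for `Y ≥ 2`. -/
theorem kexp_pow_three_le (k x : ℕ) (hx : 2 ≤ x) : kexp k x ^ 3 ≤ kexp k (x ^ 3) := by
  induction k with
  | zero => exact le_rfl
  | succ k ih =>
    rw [kexp, kexp, ← pow_mul]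
    refine Nat.pow_le_pow_right two_pos (le_trans ?_ ih)
    have h : 2 ≤ kexp k x := hx.trans (le_kexp k x)
    rw [pow_succ, Nat.mul_comm]
    exact Nat.mul_le_mul_right _ (by nlinarith)

theorem exists_kexp_bound (k t a m : ℕ) : ∃ t' a', ∀ n,
    3 * (m + 1 + 1) * ((4 * m + 16) * (n + 1) ^ 2 +
      (a * kexp k (n ^ t) + a) * ((4 * m + 16) *
        (2 * ((m + 2) * n + 1 + (a * kexp k (n ^ t) + a)) + 1) ^ 2)) ≤
      a' * kexp k (n ^ t') + a' := by
  set F : ℕ → ℕ := fun n => 3 * (m + 1 + 1) * ((4 * m + 16) * (n + 1) ^ 2 +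
      (a * kexp k (n ^ t) + a) * ((4 * m + 16) *
        (2 * ((m + 2) * n + 1 + (a * kexp k (n ^ t) + a)) + 1) ^ 2)) with hF
  set C : ℕ := 3 * (m + 1 + 1) * ((4 * m + 16) * 2 ^ 2 +
      (2 * a) * ((4 * m + 16) * (2 * ((m + 2) + 1 + 2 * a) + 1) ^ 2)) with hC
  -- With `t + 1` in place of `t`, `X = kexp k (n ^ (t + 1))` bounds `n` even if `t = 0`; the factor
  -- `3` pays for the cube. For `n < 2` powers of `n` do not grow, so `F 0 + F 1` covers these
  -- values.
  refine ⟨(t + 1) * 3, F 0 + F 1 + C, fun n => ?_⟩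
  change F n ≤ _
  rcases lt_or_ge n 2 with hn | hn
  · have : F n ≤ F 0 + F 1 := by interval_cases n <;> omega
    exact (this.trans (Nat.le_add_right _ C)).trans (Nat.le_add_left _ _)
  · set X := kexp k (n ^ (t + 1)) with hX
    have hnX : n ≤ X := (Nat.le_self_pow (Nat.succ_ne_zero t) n).trans (le_kexp k _)
    have hY : kexp k (n ^ t) ≤ X :=
      kexp_mono k (Nat.pow_le_pow_right (by omega) (Nat.le_succ t))
    have hX3 : X ^ 3 ≤ kexp k (n ^ ((t + 1) * 3)) := by
      rw [pow_mul]
      exact kexp_pow_three_le k _ (hn.trans (Nat.le_self_pow (Nat.succ_ne_zero t) n))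
    have h1X : 1 ≤ X := by omega
    have hT : a * kexp k (n ^ t) + a ≤ 2 * a * X := by nlinarith
    have hFC : F n ≤ C * X ^ 3 := by
      calc F n ≤ 3 * (m + 1 + 1) * ((4 * m + 16) * (2 * X) ^ 2 +
            (2 * a * X) * ((4 * m + 16) * ((2 * ((m + 2) + 1 + 2 * a) + 1) * X) ^ 2)) := by
              simp only [hF]
              gcongr
              · omega
              · nlinarith
        _ ≤ 3 * (m + 1 + 1) * ((4 * m + 16) * (2 ^ 2 * X ^ 3) +
            (2 * a * X) * ((4 * m + 16) * ((2 * ((m + 2) + 1 + 2 * a) + 1) * X) ^ 2)) := by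
              rw [mul_pow]
              gcongr
              norm_num
        _ = C * X ^ 3 := by rw [hC]; ring
    calc F n ≤ C * X ^ 3 := hFC
      _ ≤ (F 0 + F 1 + C) * kexp k (n ^ ((t + 1) * 3)) :=
        Nat.mul_le_mul (Nat.le_add_left _ _) hX3
      _ ≤ _ := Nat.le_add_right _ _

end Bounds

theorem Machine.DecidesInTime.mono {α : Type*} {M : Machine} {c : BlockCode α} {L : Language α}
    {T T' : ℕ → ℕ} (h : M.DecidesInTime c L T) (hT : ∀ n, T n ≤ T' n) :
    M.DecidesInTime c L T' := fun w =>
  let ⟨s, hs, h'⟩ := h w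
  ⟨s, hs.trans (hT _), h'⟩

end WOTM

theorem theorem4 {α : Type*} [Finite α] (c : WOTM.BlockCode α) (k : ℕ) :
    WOTM.DExpWOTime c k = WOTM.ExpTime c k := by
  apply Set.Subset.antisymm
  · rintro L ⟨M, t, a, -, h⟩
    exact ⟨M, t, a, h⟩
  · rintro L ⟨M, t, a, h⟩
    obtain ⟨m, hm⟩ := c.exists_width
    obtain ⟨t', a', hb⟩ := WOTM.exists_kexp_bound k t a m
    exact ⟨M.writeOnce m, t', a', M.writeOnce_isWriteOnce, (M.writeOnce_decides c hm h).mono hb⟩
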